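/- An arithmetic formula for a positive integer $n$ is an ordered full binary tree whose leaves have value $1$ and whose internal nodes are labelled $+$ or $\times$, such that the value of each internal node is the sum, respectively the product, of the values of its two children, both children of every $\times$-node have value at least $2$, and the root has value $n$. For an integer $k \ge 0$ let $f_k(n)$ be the number of arithmetic formulas for $n$ with exactly $k$ nodes labelled $\times$. For arithmetic functions $g, h$ let $$(g *' h)(n) := \sum_{d \mid n,\ 1 < d < n} g(d)\, h(n/d).$$ For $k \ge 1$ let $\mathcal{T}_k$ be the set of $k$-traces, i.e. of all triples $(p, \boldsymbol{\ell}, \mathbf{r})$ with $p$ a positive integer and $\boldsymbol{\ell} = (\ell_1, \dots, \ell_p)$, $\mathbf{r} = (r_1, \dots, r_p)$ tuples of nonnegative integers such that $\ell_1 + r_1 + \cdots + \ell_p + r_p + p = k$; let $\mathcal{T}_0$ consist of the single triple $(0, (), ())$ with $p = 0$ and empty tuples. Theorem. Let $k \ge 0$ be an integer. For all $(p, \boldsymbol{\ell}, \mathbf{r}) \in \mathcal{T}_k$ and $1 \le i \le p$ the series $\sum_{t=1}^\infty (f_{\ell_i} *' f_{r_i})(t)/4^{t-1}$ converges, and, as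 $n \to +\infty$, $$f_k(n) \sim \frac{1}{4\sqrt{\pi}}\, \frac{4^n}{n^{3/2}} \sum_{(p, \boldsymbol{\ell}, \mathbf{r}) \in \mathcal{T}_k} \frac{n^p}{p!} \prod_{i=1}^p \left( \sum_{t=1}^\infty \frac{(f_{\ell_i} *' f_{r_i})(t)}{4^{t-1}} \right),$$ where the empty product is $1$. -/

import Mathlib

open Filter Asymptotics

/-- Ordered full binary trees whose leaves are the constant `1` and whose internal nodes are
labelled `+` or `×`. -/
inductive ArithExpr : Type
  | one : ArithExpr
  | add : ArithExpr → ArithExpr → ArithExpr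
  | mul : ArithExpr → ArithExpr → ArithExpr

namespace ArithExpr

/-- The value of the root node. -/
def value : ArithExpr → ℕ
  | one => 1
  | add a b => a.value + b.value
  | mul a b => a.value * b.value

/-- The expression is an arithmetic formula: both children of every multiplicative node have
value at least `2` (multiplication by `1` is not allowed). -/
def IsFormula : ArithExpr → Prop
  | one => True
  | add a b => a.IsFormula ∧ b.IsFormula
  | mul a b => a.IsFormula ∧ b.IsFormula ∧ 2 ≤ a.value ∧ 2 ≤ b.value

/-- The number of multiplicative nodes. -/
def mulCount : ArithExpr → ℕ
  | one => 0
  | add a b => a.mulCount + b.mulCount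
  | mul a b => a.mulCount + b.mulCount + 1

theorem value_pos (A : ArithExpr) : 0 < A.value := by
  induction A with
  | one => simp [value]
  | add a b ha hb => simp only [value]; omega
  | mul a b ha hb => exact Nat.mul_pos ha hb

end ArithExpr

/-- The arithmetic formulas for `n` with exactly `k` multiplications. -/
def formulas (k n : ℕ) : Set ArithExpr :=
  {A | A.IsFormula ∧ A.value = n ∧ A.mulCount = k}

/-- The number `f_k(n)` of arithmetic formulas for `n` with exactly `k` multiplications. -/
noncomputable def numFormulas (k n : ℕ) : ℕ := (formulas k n).ncard

/-- `numFormulas` counts a finite set, so the cardinality has its usual meaning. -/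
theorem formulas_finite (k n : ℕ) : (formulas k n).Finite := by
  have key : ∀ n : ℕ, {A : ArithExpr | A.IsFormula ∧ A.value = n}.Finite := by
    intro n
    induction n using Nat.strong_induction_on with
    | _ n ih =>
      have hS : (⋃ m ∈ Set.Iio n, {A : ArithExpr | A.IsFormula ∧ A.value = m}).Finite :=
        (Set.finite_Iio n).biUnion fun m hm => ih m hm
      refine ((Set.finite_singleton ArithExpr.one).union
        ((hS.image2 ArithExpr.add hS).union (hS.image2 ArithExpr.mul hS))).subset ?_
      rintro (_ | ⟨a, b⟩ | ⟨a, b⟩) ⟨h1, h2⟩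
      · exact Or.inl rfl
      · obtain ⟨ha, hb⟩ := h1
        have pa := a.value_pos
        have pb := b.value_pos
        simp only [ArithExpr.value] at h2
        refine Or.inr (Or.inl (Set.mem_image2_of_mem ?_ ?_))
        · exact Set.mem_biUnion (x := a.value) (by simp only [Set.mem_Iio]; omega) ⟨ha, rfl⟩
        · exact Set.mem_biUnion (x := b.value) (by simp only [Set.mem_Iio]; omega) ⟨hb, rfl⟩
      · obtain ⟨ha, hb, va, vb⟩ := h1
        simp only [ArithExpr.value] at h2
        refine Or.inr (Or.inr (Set.mem_image2_of_mem ?_ ?_))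
        · exact Set.mem_biUnion (x := a.value) (by simp only [Set.mem_Iio]; nlinarith) ⟨ha, rfl⟩
        · exact Set.mem_biUnion (x := b.value) (by simp only [Set.mem_Iio]; nlinarith) ⟨hb, rfl⟩
  exact (key n).subset fun A hA => ⟨hA.1, hA.2.1⟩

/-- The proper Dirichlet convolution: the sum over the divisors `d` of `n` with `1 < d < n`. -/
def properConv {R : Type*} [Semiring R] (g h : ℕ → R) (n : ℕ) : R :=
  ∑ d ∈ n.divisors with 1 < d ∧ d < n, g d * h (n / d)

/-- Triples `(p, ℓ, r)` with `p` a nonnegative integer and `ℓ, r` tuples of `p` nonnegative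
integers. -/
abbrev PreTrace : Type := Σ p : ℕ, (Fin p → ℕ) × (Fin p → ℕ)

/-- The set of all `k`-traces. For `k = 0` the only one is the triple with `p = 0` (and empty
tuples). -/
def kTraces : ℕ → Set PreTrace
  | 0 => {⟨0, 0, 0⟩}
  | k + 1 => {τ | 0 < τ.1 ∧ (∑ i, (τ.2.1 i + τ.2.2 i)) + τ.1 = k + 1}

theorem kTraces_finite (k : ℕ) : (kTraces k).Finite := by
  cases k with
  | zero => exact Set.finite_singleton _
  | succ k =>
    let F : Finset PreTrace := (Finset.range (k + 2)).sigma fun p =>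
      (Fintype.piFinset fun _ : Fin p => Finset.range (k + 2)) ×ˢ
        (Fintype.piFinset fun _ : Fin p => Finset.range (k + 2))
    refine F.finite_toSet.subset ?_
    rintro ⟨p, l, r⟩ ⟨-, h⟩
    simp only at h
    have hi : ∀ i, l i + r i ≤ k + 1 := fun i =>
      (Finset.single_le_sum (f := fun i => l i + r i) (fun _ _ => Nat.zero_le _)
        (Finset.mem_univ i)).trans (by omega)
    simp only [F, Finset.coe_sigma, Set.mem_sigma_iff, Finset.mem_coe, Finset.mem_range,
      Finset.mem_product, Fintype.mem_piFinset]
    exact ⟨by omega, fun i => by have := hi i; omega, fun i => by have := hi i; omega⟩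

/-- The set of all `k`-traces as a finite set. -/
noncomputable def kTraceFinset (k : ℕ) : Finset PreTrace := (kTraces_finite k).toFinset

/-- The term of index `t + 1` of the series
`∑_{t ≥ 1} (f_a *′ f_b)(t) / 4 ^ (t - 1)`; here `t` runs over the nonnegative integers. -/
noncomputable def convTerm (a b t : ℕ) : ℝ :=
  ((properConv (numFormulas a) (numFormulas b) (t + 1) : ℕ) : ℝ) / (4 : ℝ) ^ t

/-! Let `z` mark the value and `w` the number of multiplications. Splitting a formula at its root
gives `F = z + w G + F²`, where `G` is the generating function of the proper convolutions `f_a *'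
f_b` (`formulaGF₂_eq`). The shifted Catalan series satisfies `C = z + C²`, so `F = C(z + w G)`.
Taylor expansion in `w` writes the generating function of `f_k` as a sum over `k`-traces of a Hasse
derivative of `C` times a product of convolution series (`formulaGF_eq`).

A proper factorization `n = d e` has `d + e ≤ n/2 + 2`, so the convolution series converge beyond
the singularity `1/4` of `C` (`absSummableAt_convGF`). Each product therefore contributes only its
value at `1/4` to the asymptotics (`tendsto_coeff_mul_div`), while the coefficients of the Hasse
derivatives are explicit (`isEquivalent_coeff_hasse_catalanGF`). All terms are nonnegative, so the
equivalences can be added. -/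

/-! ### Recursion at the root node -/

/-- The pairs of natural numbers with sum `k - 1`; there are none for `k = 0`. -/
def predAntidiagonal : ℕ → Finset (ℕ × ℕ)
  | 0 => ∅
  | k + 1 => Finset.HasAntidiagonal.antidiagonal k

theorem mem_predAntidiagonal {k : ℕ} {x : ℕ × ℕ} :
    x ∈ predAntidiagonal k ↔ x.1 + x.2 + 1 = k := by
  cases k <;> simp [predAntidiagonal]

theorem mem_formulas {k n : ℕ} {A : ArithExpr} :
    A ∈ formulas k n ↔ A.IsFormula ∧ A.value = n ∧ A.mulCount = k := Iff.rfl

section Counting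

open ArithExpr Finset Finset.HasAntidiagonal Classical in
/-- Counting arithmetic formulas by their root node. -/
theorem numFormulas_eq (k n : ℕ) :
    numFormulas k n = (if k = 0 ∧ n = 1 then 1 else 0) +
      (∑ x ∈ antidiagonal k, ∑ y ∈ antidiagonal n,
        numFormulas x.1 y.1 * numFormulas x.2 y.2) +
      ∑ x ∈ predAntidiagonal k, properConv (numFormulas x.1) (numFormulas x.2) n := by
  have card_eq : ∀ k n, numFormulas k n = #(formulas_finite k n).toFinset := fun k n =>
    Set.ncard_eq_toFinset_card _ _
  set F : ℕ → ℕ → Finset ArithExpr := fun k n => (formulas_finite k n).toFinset with hF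
  have memF : ∀ {k n A}, A ∈ F k n ↔ A.IsFormula ∧ A.value = n ∧ A.mulCount = k := by
    intro k n A; simp [hF, mem_formulas]
  set S : Finset ArithExpr := (antidiagonal k ×ˢ antidiagonal n).biUnion fun x =>
    (F x.1.1 x.2.1 ×ˢ F x.1.2 x.2.2).image fun y => ArithExpr.add y.1 y.2 with hS
  set P : Finset ArithExpr := (predAntidiagonal k ×ˢ {d ∈ n.divisors | 1 < d ∧ d < n}).biUnion
    fun x => (F x.1.1 x.2 ×ˢ F x.1.2 (n / x.2)).image fun y => ArithExpr.mul y.1 y.2 with hP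
  set O : Finset ArithExpr := if k = 0 ∧ n = 1 then {ArithExpr.one} else ∅ with hO
  have hcardO : #O = if k = 0 ∧ n = 1 then 1 else 0 := by
    rw [hO]; split_ifs <;> simp
  have hcardS : #S = ∑ x ∈ antidiagonal k, ∑ y ∈ antidiagonal n,
      numFormulas x.1 y.1 * numFormulas x.2 y.2 := by
    rw [hS, card_biUnion, sum_product]
    · refine sum_congr rfl fun x _ => sum_congr rfl fun y _ => ?_
      rw [card_image_of_injective, card_product, card_eq, card_eq]
      rintro ⟨a, b⟩ ⟨c, d⟩ h
      simpa using h
    · rintro x - y - hxy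
      rw [Function.onFun, disjoint_left]
      intro A hx hy
      simp only [mem_image, mem_product, memF, Prod.exists] at hx hy
      obtain ⟨a, b, ⟨⟨-, h1, h2⟩, -, h3, h4⟩, rfl⟩ := hx
      obtain ⟨a', b', ⟨⟨-, h1', h2'⟩, -, h3', h4'⟩, h⟩ := hy
      obtain ⟨rfl, rfl⟩ := ArithExpr.add.inj h
      exact hxy (Prod.ext (Prod.ext (h2.symm.trans h2') (h4.symm.trans h4'))
        (Prod.ext (h1.symm.trans h1') (h3.symm.trans h3')))
  have hcardP : #P = ∑ x ∈ predAntidiagonal k,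
      properConv (numFormulas x.1) (numFormulas x.2) n := by
    rw [hP, card_biUnion, sum_product]
    · refine sum_congr rfl fun x _ => sum_congr rfl fun y _ => ?_
      rw [card_image_of_injective, card_product, card_eq, card_eq]
      rintro ⟨a, b⟩ ⟨c, d⟩ h
      simpa using h
    · rintro x - y - hxy
      rw [Function.onFun, disjoint_left]
      intro A hx hy
      simp only [mem_image, mem_product, memF, Prod.exists] at hx hy
      obtain ⟨a, b, ⟨⟨-, h1, h2⟩, -, h3, h4⟩, rfl⟩ := hx
      obtain ⟨a', b', ⟨⟨-, h1', h2'⟩, -, h3', h4'⟩, h⟩ := hy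
      obtain ⟨rfl, rfl⟩ := ArithExpr.mul.inj h
      exact hxy (Prod.ext (Prod.ext (h2.symm.trans h2') (h4.symm.trans h4')) (h1.symm.trans h1'))
  have hunion : F k n = (O ∪ S) ∪ P := by
    ext A
    rw [memF, mem_union, mem_union]
    have hAO : A ∈ O ↔ k = 0 ∧ n = 1 ∧ A = one := by
      rw [hO]; split_ifs with h
      · simp [h]
      · simp only [notMem_empty, false_iff]; tauto
    rw [hAO, hS, hP]
    simp only [mem_biUnion, mem_image, mem_product, memF, HasAntidiagonal.mem_antidiagonal, Prod.exists,
      mem_predAntidiagonal, mem_filter, Nat.mem_divisors]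
    cases A with
    | one =>
      simp only [IsFormula, value, mulCount, reduceCtorEq, and_false, exists_false, or_false,
        true_and, and_true]
      omega
    | add a b =>
      simp only [IsFormula, value, mulCount, reduceCtorEq, and_false, exists_false, or_false,
        false_or]
      constructor
      · rintro ⟨⟨ha, hb⟩, h1, h2⟩
        exact ⟨_, _, _, _, ⟨h2, h1⟩, a, b, ⟨⟨ha, rfl, rfl⟩, hb, rfl, rfl⟩, rfl⟩
      · rintro ⟨i, j, u, v, ⟨h2, h1⟩, a', b', ⟨⟨ha, rfl, rfl⟩, hb, rfl, rfl⟩, h⟩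
        obtain ⟨rfl, rfl⟩ := ArithExpr.add.inj h
        exact ⟨⟨ha, hb⟩, h1, h2⟩
    | mul a b =>
      simp only [IsFormula, value, mulCount, reduceCtorEq, and_false, exists_false,
        false_or]
      have pa := a.value_pos
      have pb := b.value_pos
      constructor
      · rintro ⟨⟨ha, hb, va, vb⟩, h1, h2⟩
        refine ⟨a.mulCount, b.mulCount, a.value, ⟨h2, ⟨⟨b.value, h1.symm⟩, ?_⟩, by omega, ?_⟩,
          a, b, ⟨⟨ha, rfl, rfl⟩, hb, ?_, rfl⟩, rfl⟩
        · rw [← h1]; positivity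
        · rw [← h1]; nlinarith
        · rw [← h1, Nat.mul_div_cancel_left _ pa]
      · rintro ⟨i, j, d, ⟨h2, ⟨⟨e, rfl⟩, hn⟩, hd1, hd2⟩, a', b', ⟨⟨ha, rfl, rfl⟩, hb, hv, rfl⟩, h⟩
        obtain ⟨rfl, rfl⟩ := ArithExpr.mul.inj h
        rw [Nat.mul_div_cancel_left _ pa] at hv
        subst hv
        refine ⟨⟨ha, hb, hd1, ?_⟩, rfl, h2⟩
        by_contra hlt
        have : b'.value = 1 := by omega
        rw [this, mul_one] at hd2
        exact lt_irrefl _ hd2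
  have hOS : Disjoint O S := by
    rw [disjoint_left]
    intro A h1 h2
    rw [hO] at h1
    split_ifs at h1
    · rw [mem_singleton] at h1
      subst h1
      simp [hS] at h2
    · simp at h1
  have hOSP : Disjoint (O ∪ S) P := by
    rw [disjoint_left]
    intro A h1 h2
    rw [hP] at h2
    simp only [mem_biUnion, mem_image] at h2
    obtain ⟨_, _, _, _, rfl⟩ := h2
    rw [mem_union] at h1
    rcases h1 with h1 | h1
    · rw [hO] at h1
      split_ifs at h1 <;> simp at h1
    · simp [hS] at h1
  rw [card_eq]
  change #(F k n) = _
  rw [hunion, card_union_of_disjoint hOSP, card_union_of_disjoint hOS, hcardO, hcardS, hcardP]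

end Counting

theorem numFormulas_zero_right (k : ℕ) : numFormulas k 0 = 0 := by
  rw [numFormulas, Set.ncard_eq_zero (formulas_finite k 0)]
  ext A
  simp only [mem_formulas, Set.mem_empty_iff_false, iff_false]
  have := A.value_pos
  omega

open Finset.HasAntidiagonal (antidiagonal mem_antidiagonal)
open Finset (sum_congr range)
open scoped Topology

/-! ### Hasse derivatives and formal Taylor expansion -/

namespace PowerSeries

section Hasse

variable {R : Type*} [CommRing R]

/-- The `p`-th Hasse derivative of a power series. -/
noncomputable def hasse (p : ℕ) (f : R⟦X⟧) : R⟦X⟧ :=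
  mk fun n => ((n + p).choose p : R) * coeff (n + p) f

theorem X_pow_mul_hasse (p : ℕ) (f : R⟦X⟧) :
    X ^ p * hasse p f = mk fun n => (n.choose p : R) * coeff n f := by
  ext n
  rw [coeff_X_pow_mul', coeff_mk]
  split_ifs with h
  · rw [hasse, coeff_mk, Nat.sub_add_cancel h]
  · rw [Nat.choose_eq_zero_of_lt (not_le.mp h)]; simp

/-- Multiplying by `X ^ p` undoes the index shifts; what remains is Vandermonde's identity for each
coefficient. -/
theorem hasse_mul (p : ℕ) (f g : R⟦X⟧) :
    hasse p (f * g) = ∑ x ∈ antidiagonal p, hasse x.1 f * hasse x.2 g := by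
  apply X_pow_mul_cancel (k := p)
  rw [X_pow_mul_hasse, Finset.mul_sum]
  have : ∀ x ∈ antidiagonal p, X ^ p * (hasse x.1 f * hasse x.2 g) =
      (mk fun n => (n.choose x.1 : R) * coeff n f) *
        (mk fun n => (n.choose x.2 : R) * coeff n g) := by
    intro x hx
    rw [← X_pow_mul_hasse, ← X_pow_mul_hasse, ← mem_antidiagonal.mp hx]
    ring
  rw [sum_congr rfl this]
  ext n
  simp only [coeff_mk, map_sum, coeff_mul]
  rw [Finset.sum_comm, Finset.mul_sum]
  refine sum_congr rfl fun y hy => ?_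
  rw [← mem_antidiagonal.mp hy, Nat.add_choose_eq]
  push_cast
  rw [Finset.sum_mul]
  exact sum_congr rfl fun x _ => by ring

/-- The expansion of `f (z + w)` in powers of `w`. -/
noncomputable def taylor (f : R⟦X⟧) : R⟦X⟧⟦X⟧ := mk fun p => hasse p f

theorem taylor_add (f g : R⟦X⟧) : taylor (f + g) = taylor f + taylor g := by
  ext p n
  simp [taylor, hasse, mul_add]

theorem taylor_mul (f g : R⟦X⟧) : taylor (f * g) = taylor f * taylor g := by
  ext p : 1
  simp [taylor, coeff_mul, hasse_mul]

theorem taylor_X : taylor (X : R⟦X⟧) = C X + X := by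
  ext p n
  rcases p with _ | _ | p
  · simp [taylor, hasse, coeff_X]
  · rcases n with _ | n <;> simp [taylor, hasse, coeff_X, coeff_one]
  · simp [taylor, hasse, coeff_X]
    omega

end Hasse

/-- The factor `X ^ p` in `(X * G) ^ p` kills all terms with `p > k`. -/
theorem coeff_subst_X_mul {R : Type*} [CommRing R] (B G : R⟦X⟧) (k : ℕ) :
    coeff k (B.subst (X * G)) = ∑ p ∈ range (k + 1), coeff p B * coeff (k - p) (G ^ p) := by
  have hs : HasSubst (X * G) := HasSubst.of_constantCoeff_zero' (by simp)
  rw [coeff_subst' hs, finsum_eq_sum_of_support_subset (s := range (k + 1))]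
  · refine sum_congr rfl fun p hp => ?_
    rw [smul_eq_mul, mul_pow, coeff_X_pow_mul', if_pos]
    exact Nat.lt_succ_iff.mp (Finset.mem_range.mp hp)
  · intro p hp
    rw [Function.mem_support] at hp
    rw [Finset.mem_coe, Finset.mem_range]
    by_contra h
    apply hp
    rw [mul_pow, coeff_X_pow_mul', if_neg (by omega), smul_zero]

end PowerSeries

/-! ### The functional equation and its solution -/

open PowerSeries

/-- The generating function of the shifted Catalan numbers. -/
noncomputable def catalanGF : ℝ⟦X⟧ := X * catalanSeries.map (Nat.castRingHom ℝ)

theorem catalanGF_eq : catalanGF = X + catalanGF * catalanGF := by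
  have h := congrArg (PowerSeries.map (Nat.castRingHom ℝ)) catalanSeries_sq_mul_X_add_one
  simp only [map_add, map_mul, map_pow, map_X, map_one] at h
  rw [catalanGF]
  linear_combination (-X) * h

/-- The generating function of the arithmetic formulas with `k` multiplications. -/
noncomputable def formulaGF (k : ℕ) : ℝ⟦X⟧ := mk fun n => (numFormulas k n : ℝ)

/-- The generating function of the proper Dirichlet convolution of `f_a` and `f_b`. -/
noncomputable def convGF (a b : ℕ) : ℝ⟦X⟧ :=
  mk fun n => ((properConv (numFormulas a) (numFormulas b) n : ℕ) : ℝ)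

/-- The bivariate generating function of arithmetic formulas by value and multiplications. -/
noncomputable def formulaGF₂ : ℝ⟦X⟧⟦X⟧ := mk formulaGF

/-- The bivariate generating function of the proper convolutions. -/
noncomputable def convGF₂ : ℝ⟦X⟧⟦X⟧ := mk fun k => ∑ x ∈ antidiagonal k, convGF x.1 x.2

theorem formulaGF₂_eq :
    formulaGF₂ = C X + X * convGF₂ + formulaGF₂ * formulaGF₂ := by
  ext k n
  have h := congrArg (Nat.cast : ℕ → ℝ) (numFormulas_eq k n)
  push_cast at h
  have hG : coeff n (coeff k (X * convGF₂)) = ∑ x ∈ predAntidiagonal k,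
      ((properConv (numFormulas x.1) (numFormulas x.2) n : ℕ) : ℝ) := by
    rcases k with _ | k
    · simp [predAntidiagonal]
    · simp [predAntidiagonal, coeff_succ_X_mul, convGF₂, convGF]
  have hX : coeff n (coeff k (C (X : ℝ⟦X⟧))) = if k = 0 ∧ n = 1 then 1 else 0 := by
    rcases k with _ | k <;> simp [coeff_X, coeff_C]
  rw [map_add, map_add, map_add, map_add, hG, hX]
  simp only [formulaGF₂, coeff_mk, formulaGF, coeff_mul, map_sum, h]
  rw [add_right_comm]

/-- The difference of the equations factors as `(F - G) * (1 - F - G) = 0`, and the second factor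
has constant term `1`. -/
theorem eq_of_quadratic {R : Type*} [CommRing R] [IsDomain R] {a F G : R⟦X⟧⟦X⟧}
    (hF : F = a + F * F) (hG : G = a + G * G)
    (hF0 : constantCoeff (constantCoeff F) = 0) (hG0 : constantCoeff (constantCoeff G) = 0) :
    F = G := by
  have h : (F - G) * (1 - F - G) = 0 := by linear_combination hF - hG
  rcases mul_eq_zero.mp h with h | h
  · exact sub_eq_zero.mp h
  · have := congrArg (fun x => constantCoeff (constantCoeff x)) h
    simp [hF0, hG0] at this

/-- The Taylor expansion respects sums and products, so `C(z + w)` solves `y = z + w + y²`;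
substituting `w G` for `w` gives the equation of `formulaGF₂`. -/
theorem formulaGF₂_eq_subst : formulaGF₂ = (taylor catalanGF).subst (X * convGF₂) := by
  have hs : HasSubst (X * convGF₂) := HasSubst.of_constantCoeff_zero' (by simp)
  refine eq_of_quadratic formulaGF₂_eq ?_ ?_ ?_
  · have h : taylor catalanGF = C X + X + taylor catalanGF * taylor catalanGF := by
      conv_lhs => rw [catalanGF_eq]
      rw [taylor_add, taylor_mul, taylor_X]
    conv_lhs => rw [h]
    rw [subst_add hs, subst_add hs, subst_mul hs, subst_X hs, subst_C]
    rfl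
  · simp [formulaGF₂, formulaGF, ← coeff_zero_eq_constantCoeff_apply, numFormulas_zero_right]
  · rw [← coeff_zero_eq_constantCoeff_apply, ← coeff_zero_eq_constantCoeff_apply,
      coeff_subst_X_mul]
    simp [taylor, hasse, catalanGF]

/-! ### Expansion over traces -/

theorem mem_kTraces {k : ℕ} {τ : PreTrace} :
    τ ∈ kTraces k ↔ (∑ i, (τ.2.1 i + τ.2.2 i)) + τ.1 = k := by
  obtain ⟨p, l, r⟩ := τ
  cases k with
  | zero =>
    simp only [kTraces, Set.mem_singleton_iff]
    constructor
    · intro h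
      cases h
      simp
    · intro h
      obtain rfl : p = 0 := by omega
      exact congrArg (Sigma.mk 0) (Subsingleton.elim _ _)
  | succ k =>
    simp only [kTraces, Set.mem_ofPred_eq, and_iff_right_iff_imp]
    intro h
    rcases Nat.eq_zero_or_pos p with rfl | hp
    · simp at h
    · exact hp

theorem mem_kTraceFinset {k : ℕ} {τ : PreTrace} :
    τ ∈ kTraceFinset k ↔ (∑ i, (τ.2.1 i + τ.2.2 i)) + τ.1 = k := by
  rw [kTraceFinset, Set.Finite.mem_toFinset, mem_kTraces]

theorem formulaGF_eq (k : ℕ) :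
    formulaGF k = ∑ τ ∈ kTraceFinset k,
      hasse τ.1 catalanGF * ∏ i, convGF (τ.2.1 i) (τ.2.2 i) := by
  have h := congrArg (coeff k) formulaGF₂_eq_subst
  rw [coeff_subst_X_mul, formulaGF₂, coeff_mk] at h
  rw [h]
  have hpow : ∀ p m, coeff m (convGF₂ ^ p) =
      ∑ l ∈ Finset.univ.finsuppAntidiag (μ := ℕ) (ι := Fin p) m,
        ∑ q ∈ Fintype.piFinset fun i => antidiagonal (l i),
          ∏ i, convGF (q i).1 (q i).2 := by
    intro p m
    have : convGF₂ ^ p = ∏ _i : Fin p, convGF₂ := by simp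
    rw [this, coeff_prod]
    refine sum_congr rfl fun l _ => ?_
    rw [← Finset.prod_univ_sum (fun i => antidiagonal (l i)) fun _ x => convGF x.1 x.2]
    exact Finset.prod_congr rfl fun i _ => by rw [convGF₂, coeff_mk]
  simp only [hpow, taylor, coeff_mk, Finset.mul_sum]
  rw [Finset.sum_sigma', Finset.sum_sigma']
  -- The composition of `k - p` from the power expansion is redundant: its parts are `ℓ_i + r_i`.
  refine Finset.sum_bij' (fun x _ => (⟨x.1.1, fun i => (x.2 i).1, fun i => (x.2 i).2⟩ : PreTrace))
    (fun τ _ => ⟨⟨τ.1, Finsupp.equivFunOnFinite.symm fun i => τ.2.1 i + τ.2.2 i⟩,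
      fun i => (τ.2.1 i, τ.2.2 i)⟩) ?_ ?_ ?_ ?_ ?_
  · rintro ⟨⟨p, l⟩, q⟩ hx
    simp only [Finset.mem_sigma, Finset.mem_range, Finset.mem_finsuppAntidiag,
      Fintype.mem_piFinset, mem_antidiagonal] at hx
    rw [mem_kTraceFinset]
    simp only [hx.2, hx.1.2.1]
    omega
  · rintro ⟨p, l, r⟩ hx
    rw [mem_kTraceFinset] at hx
    simp only [Finset.mem_sigma, Finset.mem_range, Finset.mem_finsuppAntidiag,
      Fintype.mem_piFinset, mem_antidiagonal]
    simp only at hx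
    refine ⟨⟨by omega, ?_, by simp⟩, fun i => rfl⟩
    simp only [Finsupp.equivFunOnFinite_symm_apply_apply]
    omega
  · rintro ⟨⟨p, l⟩, q⟩ hx
    simp only [Finset.mem_sigma, Finset.mem_range, Finset.mem_finsuppAntidiag,
      Fintype.mem_piFinset, mem_antidiagonal] at hx
    change Fin p → ℕ × ℕ at q
    obtain rfl : (Finsupp.equivFunOnFinite.symm fun i => (q i).1 + (q i).2) = l := by
      ext i
      exact hx.2 i
    rfl
  · rintro ⟨p, l, r⟩ hx
    rfl
  · rintro ⟨⟨p, l⟩, q⟩ hx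
    rfl

/-! ### Absolute convergence and coefficients of products -/

namespace PowerSeries

/-- The power series converges absolutely at `r`. -/
def AbsSummableAt (r : ℝ) (f : ℝ⟦X⟧) : Prop := Summable fun n => ‖coeff n f * r ^ n‖

/-- The sum of a power series at `r`. -/
noncomputable def evalAt (r : ℝ) (f : ℝ⟦X⟧) : ℝ := ∑' n, coeff n f * r ^ n

theorem coeff_mul_mul_pow (r : ℝ) (f g : ℝ⟦X⟧) (n : ℕ) :
    coeff n (f * g) * r ^ n =
      ∑ x ∈ antidiagonal n, coeff x.1 f * r ^ x.1 * (coeff x.2 g * r ^ x.2) := by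
  rw [coeff_mul, Finset.sum_mul]
  refine sum_congr rfl fun x hx => ?_
  rw [← mem_antidiagonal.mp hx, pow_add]
  ring

theorem absSummableAt_one (r : ℝ) : AbsSummableAt r 1 := by
  refine summable_of_ne_finset_zero (s := {0}) fun n hn => ?_
  rw [Finset.mem_singleton] at hn
  simp [coeff_one, hn]

theorem evalAt_one (r : ℝ) : evalAt r 1 = 1 := by
  rw [evalAt, tsum_eq_single 0 fun n hn => by simp [coeff_one, hn]]
  simp

theorem AbsSummableAt.mul {r : ℝ} {f g : ℝ⟦X⟧} (hf : AbsSummableAt r f)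
    (hg : AbsSummableAt r g) : AbsSummableAt r (f * g) := by
  simp only [AbsSummableAt, coeff_mul_mul_pow]
  exact summable_norm_sum_mul_antidiagonal_of_summable_norm
    (f := fun n => coeff n f * r ^ n) (g := fun n => coeff n g * r ^ n) hf hg

theorem evalAt_mul {r : ℝ} {f g : ℝ⟦X⟧} (hf : AbsSummableAt r f)
    (hg : AbsSummableAt r g) : evalAt r (f * g) = evalAt r f * evalAt r g := by
  simp only [evalAt, coeff_mul_mul_pow]
  exact (tsum_mul_tsum_eq_tsum_sum_antidiagonal_of_summable_norm
    (f := fun n => coeff n f * r ^ n) (g := fun n => coeff n g * r ^ n) hf hg).symm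

theorem AbsSummableAt.sum {ι : Type*} {r : ℝ} {s : Finset ι} {f : ι → ℝ⟦X⟧}
    (h : ∀ i ∈ s, AbsSummableAt r (f i)) : AbsSummableAt r (∑ i ∈ s, f i) := by
  refine Summable.of_nonneg_of_le (fun n => norm_nonneg _) (fun n => ?_)
    (summable_sum (s := s) fun i hi => h i hi)
  rw [map_sum, Finset.sum_mul]
  exact norm_sum_le _ _

theorem AbsSummableAt.prod {ι : Type*} {r : ℝ} {s : Finset ι} {f : ι → ℝ⟦X⟧}
    (h : ∀ i ∈ s, AbsSummableAt r (f i)) : AbsSummableAt r (∏ i ∈ s, f i) :=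
  Finset.prod_induction _ _ (fun _ _ => AbsSummableAt.mul) (absSummableAt_one r) h

theorem evalAt_prod {ι : Type*} {r : ℝ} {s : Finset ι} {f : ι → ℝ⟦X⟧}
    (h : ∀ i ∈ s, AbsSummableAt r (f i)) :
    evalAt r (∏ i ∈ s, f i) = ∏ i ∈ s, evalAt r (f i) := by
  classical
  induction s using Finset.induction_on with
  | empty => simp [evalAt_one]
  | insert a s ha ih =>
    have hs : ∀ i ∈ s, AbsSummableAt r (f i) := fun i hi => h i (Finset.mem_insert_of_mem hi)
    rw [Finset.prod_insert ha, Finset.prod_insert ha,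
      evalAt_mul (h a (Finset.mem_insert_self a s)) (AbsSummableAt.prod hs), ih hs]

theorem AbsSummableAt.mono {r s : ℝ} {f : ℝ⟦X⟧} (hr : 0 ≤ r) (hrs : r ≤ s)
    (h : AbsSummableAt s f) : AbsSummableAt r f := by
  refine Summable.of_nonneg_of_le (fun n => norm_nonneg _) (fun n => ?_) h
  rw [norm_mul, norm_mul, norm_pow, norm_pow, Real.norm_of_nonneg hr,
    Real.norm_of_nonneg (hr.trans hrs)]
  gcongr

theorem AbsSummableAt.exists_bound {r : ℝ} {f : ℝ⟦X⟧} (hr : 0 < r) (h : AbsSummableAt r f) :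
    ∃ K, 0 ≤ K ∧ ∀ n, |coeff n f| ≤ K * r⁻¹ ^ n := by
  refine ⟨∑' n, ‖coeff n f * r ^ n‖, tsum_nonneg fun n => norm_nonneg _, fun n => ?_⟩
  have := h.le_tsum n fun j _ => norm_nonneg _
  rw [norm_mul, Real.norm_eq_abs, norm_pow, Real.norm_of_nonneg hr.le] at this
  rwa [inv_pow, ← div_eq_mul_inv, le_div_iff₀ (by positivity)]

/-- If the coefficients of `A` grow regularly with ratio `4`, then those of `A * H` are asymptotic
to `H(1/4)` times those of `A`, for `H` with radius of convergence larger than `1/4`. -/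
theorem tendsto_coeff_mul_div {A H : ℝ⟦X⟧} (hH : AbsSummableAt (1 / 3) H)
    (hA : ∀ᶠ n in atTop, 0 < coeff n A)
    (hratio : Tendsto (fun n => coeff n A / coeff (n + 1) A) atTop (𝓝 (1 / 4)))
    (hbound : ∀ n j : ℕ, |coeff n A| ≤ (1 / 4) ^ j * ((j : ℝ) + 1) ^ 4 * coeff (n + j) A) :
    Tendsto (fun n => coeff n (A * H) / coeff n A) atTop (𝓝 (evalAt (1 / 4) H)) := by
  set f : ℕ → ℕ → ℝ := fun n j =>
    if j ≤ n then coeff j H * (coeff (n - j) A / coeff n A) else 0 with hf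
  have hcoeff : ∀ n, coeff n (A * H) / coeff n A = ∑' j, f n j := by
    intro n
    rw [tsum_eq_sum (s := range (n + 1)), mul_comm, coeff_mul,
      Finset.Nat.sum_antidiagonal_eq_sum_range_succ_mk, Finset.sum_div]
    · refine sum_congr rfl fun j hj => ?_
      rw [hf]
      simp only
      rw [if_pos (Nat.lt_succ_iff.mp (Finset.mem_range.mp hj)), mul_div_assoc]
    · intro j hj
      rw [Finset.mem_range] at hj
      exact if_neg (by omega)
  simp only [hcoeff, evalAt]
  -- Since `1/4 = 1/3 * 3/4`, the gap between the radii absorbs the polynomial factor of `hbound`,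
  -- leaving a summable dominating sequence.
  have hK : Tendsto (fun j : ℕ => ((j + 1 : ℕ) : ℝ) ^ 4 * (3 / 4 : ℝ) ^ (j + 1)) atTop (𝓝 0) :=
    ((summable_pow_mul_geometric_of_norm_lt_one 4
      (by norm_num : ‖(3 / 4 : ℝ)‖ < 1)).tendsto_atTop_zero).comp (tendsto_add_atTop_nat 1)
  obtain ⟨K, hK⟩ := hK.bddAbove_range
  refine tendsto_tsum_of_dominated_convergence
    (bound := fun j => ‖coeff j H * (1 / 3) ^ j‖ * (4 / 3 * K)) (hH.mul_right _) ?_ ?_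
  · intro j
    have hpow : Tendsto (fun n => coeff n A / coeff (n + j) A) atTop (𝓝 ((1 / 4) ^ j)) := by
      induction j with
      | zero =>
        refine tendsto_const_nhds.congr' ?_
        filter_upwards [hA] with n hn
        simp [hn.ne']
      | succ j ih =>
        rw [pow_succ]
        refine (ih.mul (hratio.comp (tendsto_add_atTop_nat j))).congr' ?_
        filter_upwards [(tendsto_add_atTop_nat j).eventually hA] with n hn
        simp only [Function.comp]
        rw [div_mul_div_cancel₀ hn.ne', add_assoc]
    rw [← tendsto_add_atTop_iff_nat j]
    refine (hpow.const_mul (coeff j H)).congr fun n => ?_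
    simp [hf]
  · filter_upwards [hA] with n hn j
    simp only [hf]
    split_ifs with hj
    · have h1 := hbound (n - j) j
      rw [Nat.sub_add_cancel hj] at h1
      have h2 : (((j + 1 : ℕ) : ℝ)) ^ 4 * (3 / 4 : ℝ) ^ (j + 1) ≤ K := hK ⟨j, rfl⟩
      rw [norm_mul, norm_mul, mul_assoc, norm_div, Real.norm_of_nonneg hn.le]
      gcongr
      rw [Real.norm_of_nonneg (by positivity : (0 : ℝ) ≤ (1 / 3) ^ j), div_le_iff₀ hn]
      refine h1.trans (mul_le_mul_of_nonneg_right ?_ hn.le)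
      calc (1 / 4 : ℝ) ^ j * ((j : ℝ) + 1) ^ 4
          = (1 / 3) ^ j * (4 / 3 * ((((j + 1 : ℕ) : ℝ)) ^ 4 * (3 / 4 : ℝ) ^ (j + 1))) := by
            rw [pow_succ (3 / 4 : ℝ) j, show (1 / 4 : ℝ) = 1 / 3 * (3 / 4) by norm_num, mul_pow]
            push_cast
            ring
        _ ≤ _ := by gcongr
    · rw [norm_zero]
      refine mul_nonneg (norm_nonneg _) (mul_nonneg (by norm_num) (le_trans ?_ (hK ⟨0, rfl⟩)))
      positivity

end PowerSeries

/-! ### Recurrences and growth of the Catalan coefficients -/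

theorem coeff_succ_catalanGF (n : ℕ) : coeff (n + 1) catalanGF = catalan n := by
  simp [catalanGF, coeff_succ_X_mul]

theorem coeff_zero_catalanGF : coeff 0 catalanGF = 0 := by
  simp [catalanGF]

theorem coeff_hasse_catalanGF_nonneg (p n : ℕ) : 0 ≤ coeff n (hasse p catalanGF) := by
  rw [hasse, coeff_mk]
  refine mul_nonneg (Nat.cast_nonneg _) ?_
  cases n + p with
  | zero => rw [coeff_zero_catalanGF]
  | succ m => rw [coeff_succ_catalanGF]; exact Nat.cast_nonneg _

theorem centralBinom_succ_eq_mul_catalan (n : ℕ) :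
    (n + 1).centralBinom = 2 * (2 * n + 1) * catalan n := by
  apply Nat.eq_of_mul_eq_mul_left n.succ_pos
  rw [Nat.succ_eq_add_one, Nat.succ_mul_centralBinom_succ, ← succ_mul_catalan_eq_centralBinom]
  ring

theorem succ_mul_coeff_succ_catalanGF {m : ℕ} (hm : 0 < m) :
    ((m : ℝ) + 1) * coeff (m + 1) catalanGF = 2 * (2 * m - 1) * coeff m catalanGF := by
  obtain ⟨n, rfl⟩ : ∃ n, m = n + 1 := ⟨m - 1, by omega⟩
  rw [coeff_succ_catalanGF, coeff_succ_catalanGF]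
  have h1 := centralBinom_succ_eq_mul_catalan n
  rw [← succ_mul_catalan_eq_centralBinom] at h1
  have h2 := congrArg (Nat.cast : ℕ → ℝ) h1
  push_cast at h2 ⊢
  linear_combination h2

theorem coeff_pos_catalanGF {m : ℕ} (hm : 0 < m) : 0 < coeff m catalanGF := by
  obtain ⟨n, rfl⟩ : ∃ n, m = n + 1 := ⟨m - 1, by omega⟩
  rw [coeff_succ_catalanGF, Nat.cast_pos]
  refine Nat.pos_of_ne_zero fun h => ?_
  have := succ_mul_catalan_eq_centralBinom n
  rw [h, mul_zero] at this
  exact n.centralBinom_ne_zero this.symm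

theorem coeff_hasse_catalanGF_pos {p n : ℕ} (h : 0 < n + p) :
    0 < coeff n (hasse p catalanGF) := by
  rw [hasse, coeff_mk]
  exact mul_pos (Nat.cast_pos.mpr (Nat.choose_pos (Nat.le_add_left _ _))) (coeff_pos_catalanGF h)

theorem succ_mul_coeff_succ_hasse_catalanGF {p n : ℕ} (h : 0 < n + p) :
    ((n : ℝ) + 1) * coeff (n + 1) (hasse p catalanGF) =
      2 * (2 * (n + p) - 1) * coeff n (hasse p catalanGF) := by
  have h1 := succ_mul_coeff_succ_catalanGF h
  have h2 := congrArg (Nat.cast : ℕ → ℝ) (Nat.choose_mul_succ_eq (n + p) p)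
  rw [show n + p + 1 - p = n + 1 by omega] at h2
  simp only [hasse, coeff_mk]
  rw [show n + 1 + p = n + p + 1 by omega]
  push_cast at h1 h2
  linear_combination (-coeff (n + p + 1) catalanGF) * h2 + ((n + p).choose p : ℝ) * h1

theorem succ_mul_coeff_hasse_succ_catalanGF {p n : ℕ} (h : 0 < n + p) :
    ((p : ℝ) + 1) * coeff n (hasse (p + 1) catalanGF) =
      2 * (2 * (n + p) - 1) * coeff n (hasse p catalanGF) := by
  have h1 := succ_mul_coeff_succ_catalanGF h
  have h2 := congrArg (Nat.cast : ℕ → ℝ) (Nat.add_one_mul_choose_eq (n + p) p)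
  simp only [hasse, coeff_mk]
  rw [show n + (p + 1) = n + p + 1 by omega]
  push_cast at h1 h2
  linear_combination (-coeff (n + p + 1) catalanGF) * h2 + ((n + p).choose p : ℝ) * h1

/-- The coefficients may grow more slowly than `4 ^ n`, but the polynomial weight compensates.
Exponent `4` is the least integer that works at `n = 1`, `p = 0`, where the coefficient ratio is
`1`: `(3/2) ^ 3 < 4 < (3/2) ^ 4`. -/
theorem coeff_hasse_catalanGF_le_succ (p n : ℕ) :
    ((n : ℝ) + 1) ^ 4 * coeff n (hasse p catalanGF) ≤
      1 / 4 * (((n : ℝ) + 2) ^ 4 * coeff (n + 1) (hasse p catalanGF)) := by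
  rcases Nat.eq_zero_or_pos (n + p) with h0 | hpos
  · obtain ⟨rfl, rfl⟩ : n = 0 ∧ p = 0 := by omega
    have h1 := coeff_hasse_catalanGF_nonneg 0 1
    have : coeff 0 (hasse 0 catalanGF) = 0 := by simp [hasse, coeff_zero_catalanGF]
    rw [this]
    simp only [zero_add, mul_zero]
    positivity
  · have h1 := succ_mul_coeff_succ_hasse_catalanGF hpos
    have h2 := coeff_hasse_catalanGF_nonneg p n
    have hn : (0 : ℝ) < (n : ℝ) + 1 := by positivity
    refine le_of_mul_le_mul_left ?_ hn
    have key : 2 * ((n : ℝ) + 1) ^ 5 ≤ ((n : ℝ) + 2) ^ 4 * (2 * (n + p) - 1) := by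
      rcases Nat.eq_zero_or_pos n with rfl | hn0
      · have : (1 : ℝ) ≤ p := by exact_mod_cast (by omega : 1 ≤ p)
        norm_num
        linarith
      · obtain ⟨m, rfl⟩ : ∃ m, n = m + 1 := ⟨n - 1, by omega⟩
        have hp : (0 : ℝ) ≤ p := Nat.cast_nonneg p
        push_cast
        have : 0 ≤ ((m : ℝ) + 1 + 2) ^ 4 * (2 * (m + 1 + p) - 1) - 2 * (m + 1 + 1) ^ 5 := by
          ring_nf
          positivity
        linarith
    calc ((n : ℝ) + 1) * (((n : ℝ) + 1) ^ 4 * coeff n (hasse p catalanGF))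
        = 1 / 2 * (2 * ((n : ℝ) + 1) ^ 5) * coeff n (hasse p catalanGF) := by ring
      _ ≤ 1 / 2 * (((n : ℝ) + 2) ^ 4 * (2 * (n + p) - 1)) * coeff n (hasse p catalanGF) := by
        gcongr
      _ = _ := by linear_combination (-(1 / 4) * ((n : ℝ) + 2) ^ 4) * h1

theorem coeff_hasse_catalanGF_le (p n j : ℕ) :
    |coeff n (hasse p catalanGF)| ≤
      (1 / 4) ^ j * ((j : ℝ) + 1) ^ 4 * coeff (n + j) (hasse p catalanGF) := by
  have key : ((n : ℝ) + 1) ^ 4 * coeff n (hasse p catalanGF) ≤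
      (1 / 4) ^ j * (((n : ℝ) + j + 1) ^ 4 * coeff (n + j) (hasse p catalanGF)) := by
    induction j with
    | zero => simp
    | succ j ih =>
      refine ih.trans ?_
      rw [pow_succ (1 / 4 : ℝ) j, mul_assoc ((1 / 4 : ℝ) ^ j)]
      have := coeff_hasse_catalanGF_le_succ p (n + j)
      push_cast at this ⊢
      rw [show (n : ℝ) + (j + 1) + 1 = n + j + 2 by ring, ← add_assoc n j 1]
      have h4 : (0 : ℝ) ≤ (1 / 4) ^ j := by positivity
      exact mul_le_mul_of_nonneg_left this h4
  have h1 := coeff_hasse_catalanGF_nonneg p (n + j)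
  rw [abs_of_nonneg (coeff_hasse_catalanGF_nonneg p n)]
  have hn : (0 : ℝ) < ((n : ℝ) + 1) ^ 4 := by positivity
  refine le_of_mul_le_mul_left (key.trans ?_) hn
  calc (1 / 4 : ℝ) ^ j * (((n : ℝ) + j + 1) ^ 4 * coeff (n + j) (hasse p catalanGF))
      ≤ (1 / 4 : ℝ) ^ j * ((((n : ℝ) + 1) * (j + 1)) ^ 4 * coeff (n + j) (hasse p catalanGF)) := by
        gcongr
        -- `n + j + 1 ≤ (n + 1) * (j + 1)` makes the bound uniform in `n`.
        nlinarith [mul_nonneg (Nat.cast_nonneg (α := ℝ) n) (Nat.cast_nonneg (α := ℝ) j)]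
    _ = _ := by ring

theorem eventually_coeff_hasse_catalanGF_pos (p : ℕ) :
    ∀ᶠ n in atTop, 0 < coeff n (hasse p catalanGF) := by
  filter_upwards [eventually_gt_atTop 0] with n hn
  exact coeff_hasse_catalanGF_pos (by omega)

theorem tendsto_coeff_hasse_catalanGF_ratio (p : ℕ) :
    Tendsto (fun n => coeff (n + 1) (hasse p catalanGF) / coeff n (hasse p catalanGF)) atTop
      (𝓝 4) := by
  have h : Tendsto (fun n : ℕ => (4 : ℝ) + (4 * p - 6) * (1 / ((n : ℝ) + 1))) atTop
      (𝓝 (4 + (4 * p - 6) * 0)) :=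
    (tendsto_one_div_add_atTop_nhds_zero_nat.const_mul _).const_add _
  rw [mul_zero, add_zero] at h
  refine h.congr' ?_
  filter_upwards [eventually_gt_atTop 0] with n hn
  have h1 := succ_mul_coeff_succ_hasse_catalanGF (p := p) (n := n) (by omega)
  have h2 := coeff_hasse_catalanGF_pos (p := p) (n := n) (by omega)
  rw [eq_div_iff h2.ne']
  have hn : (n : ℝ) + 1 ≠ 0 := by positivity
  field_simp
  linear_combination -h1

theorem absSummableAt_hasse_catalanGF (p : ℕ) : AbsSummableAt (1 / 5) (hasse p catalanGF) := by
  have h := (tendsto_coeff_hasse_catalanGF_ratio p).mul_const (1 / 5)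
  refine (summable_of_ratio_test_tendsto_lt_one (l := 4 * (1 / 5)) (by norm_num) ?_ ?_).norm
  · filter_upwards [eventually_coeff_hasse_catalanGF_pos p] with n hn
    positivity
  · refine h.congr' ?_
    filter_upwards [eventually_coeff_hasse_catalanGF_pos p] with n hn
    have := coeff_hasse_catalanGF_nonneg p (n + 1)
    rw [Real.norm_of_nonneg (by positivity), Real.norm_of_nonneg (by positivity), pow_succ]
    field_simp

/-! ### Radius of convergence of the convolution series -/

theorem absSummableAt_convGF {a b : ℕ} (ha : AbsSummableAt (1 / 5) (formulaGF a))
    (hb : AbsSummableAt (1 / 5) (formulaGF b)) : AbsSummableAt (1 / 3) (convGF a b) := by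
  obtain ⟨K, hK, ha⟩ := ha.exists_bound (by norm_num)
  obtain ⟨L, hL, hb⟩ := hb.exists_bound (by norm_num)
  simp only [formulaGF, coeff_mk, Nat.abs_cast] at ha hb
  -- `5/2` is a rational number between `√5` and `3`: halving the exponent turns growth `5 ^ n` into
  -- at most `(5/2) ^ n`, which is summable against `(1/3) ^ n`.
  have hpow : ∀ d : ℕ, (1 / 5 : ℝ)⁻¹ ^ d ≤ (5 / 2) ^ (2 * d) := fun d => by
    rw [pow_mul]
    exact pow_le_pow_left₀ (by norm_num) (by norm_num) d
  have hterm : ∀ n, (coeff n (convGF a b) : ℝ) ≤ n * (K * L * (5 / 2) ^ (n + 4)) := by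
    intro n
    rw [convGF, coeff_mk, properConv]
    push_cast
    have hcard : (({d ∈ n.divisors | 1 < d ∧ d < n} : Finset ℕ).card : ℝ) ≤ n := by
      exact_mod_cast (Finset.card_filter_le _ _).trans n.card_divisors_le_self
    refine (Finset.sum_le_card_nsmul _ _ (K * L * (5 / 2) ^ (n + 4)) fun d hd => ?_).trans ?_
    · rw [Finset.mem_filter, Nat.mem_divisors] at hd
      obtain ⟨⟨⟨e, rfl⟩, -⟩, hd1, hd2⟩ := hd
      rw [Nat.mul_div_cancel_left _ (by omega)]
      have he : 2 ≤ e := by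
        by_contra he
        have : d * e ≤ d * 1 := Nat.mul_le_mul_left d (by omega)
        omega
      -- This is `0 ≤ (d - 2) * (e - 2)`.
      have hexp : 2 * d + 2 * e ≤ d * e + 4 := by nlinarith
      calc (numFormulas a d : ℝ) * numFormulas b e
          ≤ (K * (5 / 2) ^ (2 * d)) * (L * (5 / 2) ^ (2 * e)) := by
            gcongr
            · exact (ha d).trans (by gcongr; exact hpow d)
            · exact (hb e).trans (by gcongr; exact hpow e)
        _ = K * L * (5 / 2) ^ (2 * d + 2 * e) := by rw [pow_add]; ring
        _ ≤ _ := by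
          gcongr
          norm_num
    · rw [nsmul_eq_mul]
      gcongr
  have hs : Summable fun n : ℕ => K * L * (5 / 2) ^ 4 * ((n : ℝ) ^ 1 * (5 / 6 : ℝ) ^ n) :=
    (summable_pow_mul_geometric_of_norm_lt_one 1
      (by norm_num : ‖(5 / 6 : ℝ)‖ < 1)).mul_left _
  refine Summable.of_nonneg_of_le (fun n => norm_nonneg _) (fun n => ?_) hs
  have h0 : (0 : ℝ) ≤ coeff n (convGF a b) := by simp [convGF]
  rw [Real.norm_of_nonneg (by positivity)]
  refine (mul_le_mul_of_nonneg_right (hterm n) (by positivity)).trans (le_of_eq ?_)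
  rw [show (5 / 6 : ℝ) = 5 / 2 * (1 / 3) by norm_num, mul_pow, pow_add]
  ring

/-- Every `ℓ_i` and `r_i` in a `k`-trace is less than `k`, as `p ≥ 1` whenever an index `i` exists;
hence strong induction. Any radius just below `1/4` is enough here. -/
theorem absSummableAt_formulaGF (k : ℕ) : AbsSummableAt (1 / 5) (formulaGF k) := by
  induction k using Nat.strong_induction_on with
  | _ k ih =>
    rw [formulaGF_eq]
    refine AbsSummableAt.sum fun τ hτ => (absSummableAt_hasse_catalanGF _).mul
      (AbsSummableAt.prod fun i _ => ?_)
    rw [mem_kTraceFinset] at hτ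
    have h1 : τ.2.1 i + τ.2.2 i ≤ ∑ i, (τ.2.1 i + τ.2.2 i) :=
      Finset.single_le_sum (f := fun i => τ.2.1 i + τ.2.2 i) (fun _ _ => Nat.zero_le _)
        (Finset.mem_univ i)
    have h2 : 0 < τ.1 := i.pos
    exact (absSummableAt_convGF (ih _ (by omega)) (ih _ (by omega))).mono (by norm_num)
      (by norm_num)

theorem absSummableAt_convGF_one_third (a b : ℕ) : AbsSummableAt (1 / 3) (convGF a b) :=
  absSummableAt_convGF (absSummableAt_formulaGF a) (absSummableAt_formulaGF b)

/-! ### Asymptotics of the Catalan coefficients -/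

/-- The square of the sequence is `n / (2 * n + 1)` divided by the Wallis product, with limit `(1/2)
/ (π/2)`. -/
theorem tendsto_centralBinom_mul_sqrt :
    Tendsto (fun n : ℕ => (n.centralBinom : ℝ) * √n / 4 ^ n) atTop (𝓝 (1 / √Real.pi)) := by
  have h2 : Tendsto (fun n : ℕ => (n : ℝ) / (2 * n + 1)) atTop (𝓝 (1 / 2)) :=
    Stirling.tendsto_self_div_two_mul_self_add_one
  have h3 := (h2.div Real.Wallis.tendsto_W_nhds_pi_div_two (by positivity)).sqrt
  have e : 1 / √Real.pi = √(1 / 2 / (Real.pi / 2)) := by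
    rw [← Real.sqrt_one, ← Real.sqrt_div zero_le_one, Real.sqrt_one]
    congr 1
    field_simp
  rw [e]
  refine h3.congr fun n => ?_
  have hW := Real.Wallis.W_pos n
  rw [Pi.div_apply, Real.sqrt_eq_iff_mul_self_eq (by positivity) (by positivity), Real.Wallis.W_eq_factorial_ratio]
  have hc : ((2 * n).factorial : ℝ) = n.centralBinom * n.factorial * n.factorial := by
    have := Nat.choose_mul_factorial_mul_factorial (show n ≤ 2 * n by omega)
    rw [show 2 * n - n = n by omega, ← Nat.centralBinom_eq_two_mul_choose] at this
    exact_mod_cast this.symm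
  have hb : (n.centralBinom : ℝ) ≠ 0 := by exact_mod_cast n.centralBinom_ne_zero
  have hsq : √(n : ℝ) ^ 2 = n := Real.sq_sqrt (Nat.cast_nonneg n)
  have h4 : (2 : ℝ) ^ (4 * n) = (4 ^ n) ^ 2 := by
    rw [← pow_mul, mul_comm n 2, pow_mul, pow_mul]; norm_num
  rw [hc, h4]
  field_simp
  linear_combination -hsq

theorem isEquivalent_coeff_catalanGF :
    (fun n : ℕ => coeff n catalanGF) ~[atTop]
      fun n : ℕ => 1 / (4 * √Real.pi) * ((4 : ℝ) ^ n / (n : ℝ) ^ (3 / 2 : ℝ)) := by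
  refine isEquivalent_of_tendsto_one ?_
  have h2 : Tendsto (fun n : ℕ => (n : ℝ) / (2 * n + 1)) atTop (𝓝 (1 / 2)) :=
    Stirling.tendsto_self_div_two_mul_self_add_one
  have h3 := (tendsto_centralBinom_mul_sqrt.const_mul √Real.pi)
  have hpi : √Real.pi ≠ 0 := by positivity
  rw [mul_one_div_cancel hpi] at h3
  have h4 : Tendsto (fun n : ℕ => (2 * (n : ℝ) / (2 * n - 1))) atTop (𝓝 1) := by
    have h5 : Tendsto (fun n : ℕ => 1 - 1 / 2 * (1 / (n : ℝ))) atTop (𝓝 (1 - 1 / 2 * 0)) :=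
      (tendsto_one_div_atTop_nhds_zero_nat.const_mul _).const_sub _
    have h6 := h5.inv₀ (by norm_num)
    norm_num at h6
    refine h6.congr' ?_
    filter_upwards [eventually_gt_atTop 0] with n hn
    have : (1 : ℝ) ≤ n := by exact_mod_cast hn
    have : 2 * (n : ℝ) - 1 ≠ 0 := by linarith
    rw [← inv_div]
    field_simp
  have h7 := h3.mul h4
  rw [mul_one] at h7
  refine h7.congr' ?_
  filter_upwards [eventually_gt_atTop 0] with n hn
  obtain ⟨m, rfl⟩ : ∃ m, n = m + 1 := ⟨n - 1, by omega⟩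
  have hc := centralBinom_succ_eq_mul_catalan m
  rw [hc, Pi.div_apply, coeff_succ_catalanGF]
  push_cast
  have hx : (0 : ℝ) < (m : ℝ) + 1 := by positivity
  have hrp : ((m : ℝ) + 1) ^ (3 / 2 : ℝ) = (m + 1) * √(m + 1) := by
    rw [show (3 / 2 : ℝ) = 1 + 1 / 2 by norm_num, Real.rpow_add hx, Real.rpow_one,
      Real.sqrt_eq_rpow]
  have hm : 2 * ((m : ℝ) + 1) - 1 = 2 * m + 1 := by ring
  have hm' : 2 * (m : ℝ) + 1 ≠ 0 := by positivity
  rw [hrp, hm]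
  field_simp
  ring

/-- Raising `p` by one multiplies the coefficient by `2 * (2 * (n + p) - 1) / (p + 1)`, which is
asymptotic to `4 * n / (p + 1)`. -/
theorem isEquivalent_coeff_hasse_catalanGF (p : ℕ) :
    (fun n : ℕ => coeff n (hasse p catalanGF)) ~[atTop]
      fun n : ℕ => 1 / (4 * √Real.pi) * ((4 : ℝ) ^ n / (n : ℝ) ^ (3 / 2 : ℝ)) *
        ((n : ℝ) ^ p / (p.factorial : ℝ) * 4 ^ p) := by
  induction p with
  | zero => simpa [hasse] using isEquivalent_coeff_catalanGF
  | succ p ih =>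
    have h1 : (fun n : ℕ => 2 * (2 * ((n : ℝ) + p) - 1) / (p + 1)) ~[atTop]
        fun n : ℕ => 4 * (n : ℝ) / (p + 1) := by
      refine isEquivalent_of_tendsto_one ?_
      have h5 : Tendsto (fun n : ℕ => 1 + (2 * p - 1) / 2 * (1 / (n : ℝ))) atTop
          (𝓝 (1 + (2 * p - 1) / 2 * 0)) :=
        (tendsto_one_div_atTop_nhds_zero_nat.const_mul _).const_add _
      rw [mul_zero, add_zero] at h5
      refine h5.congr' ?_
      filter_upwards [eventually_gt_atTop 0] with n hn
      have : (n : ℝ) ≠ 0 := by positivity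
      rw [Pi.div_apply]
      field_simp
      ring
    refine ((ih.mul h1).congr_left ?_).congr_right ?_
    · filter_upwards [eventually_gt_atTop 0] with n hn
      have := succ_mul_coeff_hasse_succ_catalanGF (p := p) (n := n) (by omega)
      rw [Pi.mul_apply, mul_div_assoc', div_eq_iff (by positivity)]
      linear_combination -this
    · refine Eventually.of_forall fun n => ?_
      simp only [Pi.mul_apply, Nat.factorial_succ, pow_succ _ p]
      push_cast
      field_simp

/-! ### Summing the contributions of the traces -/

/-- Nonnegativity rules out cancellation, so each error is small relative to the whole sum. -/
theorem IsEquivalent.sum_of_nonneg {ι : Type*} {s : Finset ι} {u v : ι → ℕ → ℝ}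
    (h : ∀ i ∈ s, u i ~[atTop] v i) (hv : ∀ i ∈ s, ∀ n, 0 ≤ v i n) :
    (fun n => ∑ i ∈ s, u i n) ~[atTop] fun n => ∑ i ∈ s, v i n := by
  have key : (fun n => ∑ i ∈ s, (u i n - v i n)) =o[atTop] fun n => ∑ i ∈ s, v i n := by
    refine IsLittleO.fun_sum fun i hi => (h i hi).isLittleO.trans_isBigO ?_
    refine IsBigO.of_bound 1 (Eventually.of_forall fun n => ?_)
    rw [Real.norm_of_nonneg (hv i hi n),
      Real.norm_of_nonneg (Finset.sum_nonneg fun j hj => hv j hj n), one_mul]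
    exact Finset.single_le_sum (f := fun j => v j n) (fun j hj => hv j hj n) hi
  refine key.congr_left fun n => ?_
  rw [Pi.sub_apply, Finset.sum_sub_distrib]

theorem coeff_convGF_nonneg (a b n : ℕ) : 0 ≤ coeff n (convGF a b) := by
  simp [convGF]

theorem coeff_prod_nonneg {ι : Type*} {s : Finset ι} {f : ι → ℝ⟦X⟧}
    (h : ∀ i ∈ s, ∀ n, 0 ≤ coeff n (f i)) (n : ℕ) : 0 ≤ coeff n (∏ i ∈ s, f i) := by
  refine Finset.prod_induction f (fun g => ∀ n, 0 ≤ coeff n g) (fun a b ha hb n => ?_)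
    (fun n => ?_) h n
  · rw [coeff_mul]
    exact Finset.sum_nonneg fun x _ => mul_nonneg (ha _) (hb _)
  · rw [coeff_one]
    split_ifs <;> norm_num

theorem coeff_succ_convGF_mul (a b t : ℕ) :
    coeff (t + 1) (convGF a b) * (1 / 4) ^ (t + 1) = 1 / 4 * convTerm a b t := by
  rw [convGF, coeff_mk, convTerm, pow_succ, one_div_pow]
  ring

theorem summable_convTerm (a b : ℕ) : Summable (convTerm a b) := by
  have h : AbsSummableAt (1 / 4) (convGF a b) :=
    (absSummableAt_convGF_one_third a b).mono (by norm_num) (by norm_num)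
  have h1 := ((summable_nat_add_iff 1).mpr h.of_norm).mul_left 4
  simp only [coeff_succ_convGF_mul] at h1
  refine h1.congr fun t => ?_
  ring

theorem evalAt_convGF (a b : ℕ) :
    evalAt (1 / 4) (convGF a b) = 1 / 4 * ∑' t, convTerm a b t := by
  have h : AbsSummableAt (1 / 4) (convGF a b) :=
    (absSummableAt_convGF_one_third a b).mono (by norm_num) (by norm_num)
  rw [evalAt, h.of_norm.tsum_eq_zero_add]
  simp only [coeff_succ_convGF_mul]
  rw [tsum_mul_left]
  simp [convGF, properConv]

theorem isEquivalent_coeff_hasse_mul {p : ℕ} {H : ℝ⟦X⟧} (hH : AbsSummableAt (1 / 3) H)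
    (h0 : ∀ n, 0 ≤ coeff n H) :
    (fun n : ℕ => coeff n (hasse p catalanGF * H)) ~[atTop]
      fun n : ℕ => coeff n (hasse p catalanGF) * evalAt (1 / 4) H := by
  have h4 : AbsSummableAt (1 / 4) H := hH.mono (by norm_num) (by norm_num)
  -- If the value vanishes, no quotient can be formed, but then nonnegativity forces `H = 0`.
  by_cases hE : evalAt (1 / 4) H = 0
  · have : H = 0 := by
      ext n
      have h1 := (h4.of_norm.hasSum_iff.mpr hE)
      rw [hasSum_zero_iff_of_nonneg fun n => mul_nonneg (h0 n) (by positivity)] at h1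
      have h2 := congrFun h1 n
      simpa using h2
    subst this
    rw [hE]
    simp only [mul_zero, map_zero]
    exact IsEquivalent.refl
  · refine isEquivalent_of_tendsto_one ?_
    have hr := (tendsto_coeff_hasse_catalanGF_ratio p).inv₀ (by norm_num)
    simp only [inv_div] at hr
    have h1 := tendsto_coeff_mul_div hH (eventually_coeff_hasse_catalanGF_pos p)
      (by simpa using hr) (coeff_hasse_catalanGF_le p)
    have h2 := h1.div_const (evalAt (1 / 4) H)
    rw [div_self hE] at h2
    refine h2.congr fun n => ?_
    rw [Pi.div_apply, div_div]

theorem theorem3 (k : ℕ) :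
    (∀ τ ∈ kTraces k, ∀ i : Fin τ.1, Summable (convTerm (τ.2.1 i) (τ.2.2 i))) ∧
    (fun n : ℕ => (numFormulas k n : ℝ)) ~[atTop]
      (fun n : ℕ => 1 / (4 * Real.sqrt Real.pi) * ((4 : ℝ) ^ n / (n : ℝ) ^ (3 / 2 : ℝ)) *
        ∑ τ ∈ kTraceFinset k, ((n : ℝ) ^ τ.1 / (Nat.factorial τ.1 : ℝ)) *
          ∏ i : Fin τ.1, ∑' t : ℕ, convTerm (τ.2.1 i) (τ.2.2 i) t) := by
  refine ⟨fun τ _ i => summable_convTerm _ _, ?_⟩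
  have hf : (fun n : ℕ => (numFormulas k n : ℝ)) = fun n => ∑ τ ∈ kTraceFinset k,
      coeff n (hasse τ.1 catalanGF * ∏ i, convGF (τ.2.1 i) (τ.2.2 i)) := by
    ext n
    have h := congrArg (coeff n) (formulaGF_eq k)
    rwa [formulaGF, coeff_mk, map_sum] at h
  rw [hf]
  simp only [Finset.mul_sum]
  refine IsEquivalent.sum_of_nonneg (fun τ _ => ?_) fun τ _ n => ?_
  · have hs : ∀ i ∈ Finset.univ, AbsSummableAt (1 / 3) (convGF (τ.2.1 i) (τ.2.2 i)) :=
      fun i _ => absSummableAt_convGF_one_third _ _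
    refine ((isEquivalent_coeff_hasse_mul (AbsSummableAt.prod hs)
      (coeff_prod_nonneg fun i _ => coeff_convGF_nonneg _ _)).trans
      ((isEquivalent_coeff_hasse_catalanGF τ.1).mul IsEquivalent.refl)).congr_right ?_
    refine Eventually.of_forall fun n => ?_
    rw [Pi.mul_apply, evalAt_prod fun i _ =>
      (absSummableAt_convGF_one_third _ _).mono (by norm_num) (by norm_num)]
    -- Each convolution factor brings `1/4`, since the series is normalized by `4 ^ (t - 1)`; these
    -- cancel the `4 ^ p` from the Hasse derivative.
    simp only [evalAt_convGF, Finset.prod_mul_distrib, Finset.prod_const, Finset.card_univ,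
      Fintype.card_fin, one_div_pow]
    field_simp
  · have : 0 ≤ ∏ i : Fin τ.1, ∑' t : ℕ, convTerm (τ.2.1 i) (τ.2.2 i) t :=
      Finset.prod_nonneg fun i _ => tsum_nonneg fun t => by rw [convTerm]; positivity
    positivity
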